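/- For $n\ge 1$ and a permutation $\pi=\pi_1\pi_2\cdots\pi_n$ in the symmetric group $\mathfrak S_n$ let $$\widehat D(\pi)=\{1\le i\le n-1:\ i \text{ even and } \pi_i<\pi_{i+1}\}\cup\{1\le i\le n-1:\ i\text{ odd and }\pi_i>\pi_{i+1}\},$$ $\mathrm{altdes}(\pi)=|\widehat D(\pi)|$, $\mathrm{altmaj}(\pi)=\sum_{i\in\widehat D(\pi)} i$, and $$\widehat A_n(t,q)=\sum_{\pi\in\mathfrak S_n}t^{\mathrm{altdes}(\pi)}q^{\mathrm{altmaj}(\pi)}.$$ Let the Euler number $E_n$ be the number of $\pi\in\mathfrak S_n$ with $\pi_1>\pi_2<\pi_3>\pi_4<\cdots$. A polynomial $h(q)=\sum_{i=0}^N h_iq^i$ of degree $N$ is called palindromic if $h_i=h_{N-i}$ for all $0\le i\le N$. Theorem. For every $n\ge1$ there is a palindromic polynomial $\widehat E_n(q)\in\mathbb Z[q]$ with constant term $E_n$ such that $$\widehat A_n(1,q)=\sum_{\pi\in\mathfrak S_n}q^{\mathrm{altmaj}(\pi)}=\widehat E_n(q)\prod_{k=1}^{\lfloor\log_2 n\rfloor}\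 \prod_{i=1}^{\lfloor n/2^k\rfloor}(1+q^i).$$ This is a $q$-analog of writing $n!=2^\ell m$ with $m$ odd: at $q=1$ it becomes $n!=2^{\ell}\,\widehat E_n(1)$ with $\ell=\sum_{k=1}^{\lfloor\log_2 n\rfloor}\lfloor n/2^k\rfloor$ and $\widehat E_n(1)$ odd. Moreover, for every $m\ge1$, the polynomial $(1+q^m)^{\lfloor n/(2m)\rfloor}$ divides $\widehat A_n(1,q)$ in $\mathbb Z[q]$. -/

import Mathlib

open Polynomial

namespace AltMaj

/-- The entry `π_i` (positions and values in `{1, …, n}`) of a permutation `π` of `n` letters,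
written in one-line notation. Positions outside `{1, …, n}` get the value `0`; they are never
used below. -/
def entry {n : ℕ} (π : Equiv.Perm (Fin n)) (i : ℕ) : ℕ :=
  if h : 1 ≤ i ∧ i ≤ n then (π ⟨i - 1, by omega⟩ : ℕ) + 1 else 0

/-- The set of alternating descents: the even positions `i` with `π_i < π_{i+1}` and the odd
positions `i` with `π_i > π_{i+1}`, where `1 ≤ i ≤ n - 1`. -/
def altDescents {n : ℕ} (π : Equiv.Perm (Fin n)) : Finset ℕ :=
  (Finset.Ico 1 n).filter fun i =>
    (Even i ∧ entry π i < entry π (i + 1)) ∨ (Odd i ∧ entry π (i + 1) < entry π i)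

/-- The number of alternating descents. -/
def altdes {n : ℕ} (π : Equiv.Perm (Fin n)) : ℕ :=
  (altDescents π).card

/-- The alternating major index: the sum of all alternating descents. -/
def altmaj {n : ℕ} (π : Equiv.Perm (Fin n)) : ℕ :=
  ∑ i ∈ altDescents π, i

/-- The polynomial `∑_π t ^ altdes π * q ^ altmaj π`. The outer variable is `t`, the inner one
(in the coefficients) is `q`. -/
noncomputable def altPoly (n : ℕ) : ℤ[X][X] :=
  ∑ π : Equiv.Perm (Fin n), (X : ℤ[X][X]) ^ altdes π * C ((X : ℤ[X]) ^ altmaj π)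

/-- Down-up permutations: `π_1 > π_2 < π_3 > π_4 < ⋯`. -/
def IsDownUp {n : ℕ} (π : Equiv.Perm (Fin n)) : Prop :=
  ∀ i ∈ Finset.Ico 1 n,
    (Odd i → entry π (i + 1) < entry π i) ∧ (Even i → entry π i < entry π (i + 1))

/-- The Euler number: the number of down-up permutations of `n` letters. -/
noncomputable def eulerNumber (n : ℕ) : ℕ :=
  Nat.card {π : Equiv.Perm (Fin n) // IsDownUp π}

/-- `h = ∑_{i=0}^N h_i q^i` is palindromic of center `N / 2`: `h_i = h_{N-i}` for all
`0 ≤ i ≤ ⌊N/2⌋`. -/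
def IsPalindromic (h : ℤ[X]) (N : ℕ) : Prop :=
  h.natDegree ≤ N ∧ ∀ i ≤ N / 2, h.coeff i = h.coeff (N - i)

end AltMaj

namespace AltMaj

/-! Let `A n` be the sum of `q ^ altmaj π`. It is a product of ascent weights `u i` and descent
weights `d i`, summed over permutations. Tracking the last letter gives a binomial recursion
(`weightSum_succ`). Dividing `d n * A n` by the product of the `u i - d i = ±(1 - q ^ i)`, `1 ≤ i ≤
n`, turns it into `u n * b n = d n * ∑ k, n.choose k * b k`.

Solved naively, this brings in a denominator `1 - q ^ n` at every `n`. For even `n` it can be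
avoided: the exponential generating function of `b` satisfies a quadratic identity
(`coeff_rescale_sq_add_sq`) that yields the even coefficients from earlier ones by dividing only by
`8 * q ^ n`. So the denominators of `b n` involve only `q` and `1 - q ^ i` with `i` odd, which are
coprime over `ℚ` to every `1 + q ^ j` (`coprimeToOneAddPow_one_sub_pow`).

Hence any product of factors `1 + q ^ j` that divides `∏ (1 - q ^ i)`, `1 ≤ i ≤ n`, also divides `A
n` (`dvd_altmajSum`). Both divisibility claims follow from `1 - q ^ (2 * i) = (1 - q ^ i) * (1 + q ^
i)`. The quotient is palindromic because complementing values makes `A n` palindromic, and its value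
at `1` is odd by Legendre's formula. -/

/-! ### Recursion for weighted sums by the last letter -/

/-- The permutation with last value `j` whose other values are ordered like those of `σ`. -/
def insertLast {n : ℕ} (j : Fin (n + 1)) (σ : Equiv.Perm (Fin n)) : Equiv.Perm (Fin (n + 1)) :=
  (finSuccEquivLast.trans (Equiv.optionCongr σ)).trans (finSuccEquiv' j).symm

@[simp] lemma insertLast_last {n : ℕ} (j : Fin (n + 1)) (σ : Equiv.Perm (Fin n)) :
    insertLast j σ (Fin.last n) = j := by
  simp [insertLast]

@[simp] lemma insertLast_castSucc {n : ℕ} (j : Fin (n + 1)) (σ : Equiv.Perm (Fin n)) (i : Fin n) :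
    insertLast j σ i.castSucc = j.succAbove (σ i) := by
  simp [insertLast]

lemma insertLast_bijective (n : ℕ) :
    Function.Bijective fun p : Fin (n + 1) × Equiv.Perm (Fin n) => insertLast p.1 p.2 := by
  rw [Fintype.bijective_iff_injective_and_card]
  constructor
  · rintro ⟨j, σ⟩ ⟨k, τ⟩ h
    have hjk : j = k := by
      have := congrArg (fun π => π (Fin.last n)) h
      simpa using this
    subst hjk
    have : σ = τ := by
      ext1 i
      have := congrArg (fun π => π i.castSucc) h
      simpa using this
    rw [this]
  · simp [Fintype.card_perm, Nat.factorial_succ]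

lemma sum_perm_succ {R : Type*} [AddCommMonoid R] (n : ℕ) (f : Equiv.Perm (Fin (n + 1)) → R) :
    ∑ π, f π = ∑ j, ∑ σ : Equiv.Perm (Fin n), f (insertLast j σ) := by
  rw [← Fintype.sum_prod_type']
  exact (Fintype.sum_bijective _ (insertLast_bijective n) _ _ fun _ => rfl).symm

lemma entry_succ {n : ℕ} (π : Equiv.Perm (Fin n)) (i : Fin n) :
    entry π (i + 1) = (π i : ℕ) + 1 := by
  simp [entry]

/-- The product of the weights `u i` over the ascents and `d i` over the descents of `π`. -/
def weight {R : Type*} [CommRing R] (u d : ℕ → R) {n : ℕ} (π : Equiv.Perm (Fin n)) : R :=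
  ∏ i ∈ Finset.Ico 1 n, if entry π i < entry π (i + 1) then u i else d i

/-- The sum of the weights of all permutations of `n` letters. -/
def weightSum {R : Type*} [CommRing R] (u d : ℕ → R) (n : ℕ) : R :=
  ∑ π : Equiv.Perm (Fin n), weight u d π

lemma entry_insertLast_lt_iff {n : ℕ} (j : Fin (n + 1)) (σ : Equiv.Perm (Fin n)) {i : ℕ}
    (hi : i ∈ Finset.Ico 1 n) :
    entry (insertLast j σ) i < entry (insertLast j σ) (i + 1) ↔ entry σ i < entry σ (i + 1) := by
  obtain ⟨h1, h2⟩ := Finset.mem_Ico.1 hi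
  obtain ⟨k, rfl⟩ : ∃ k, i = k + 1 := ⟨i - 1, by omega⟩
  rw [show k + 1 = ((⟨k, by omega⟩ : Fin n).castSucc : ℕ) + 1 from rfl, entry_succ,
    show ((⟨k, by omega⟩ : Fin n).castSucc : ℕ) + 1 + 1
      = ((⟨k + 1, by omega⟩ : Fin n).castSucc : ℕ) + 1 from rfl, entry_succ,
    insertLast_castSucc, insertLast_castSucc, Fin.val_castSucc, Fin.val_castSucc, entry_succ,
    entry_succ]
  simp only [add_lt_add_iff_right, Fin.val_fin_lt, Fin.succAbove_lt_succAbove_iff]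

lemma weight_insertLast {R : Type*} [CommRing R] (u d : ℕ → R) {n : ℕ} (j : Fin (n + 2))
    (σ : Equiv.Perm (Fin (n + 1))) :
    weight u d (insertLast j σ) =
      weight u d σ * if (σ (Fin.last n) : ℕ) < j then u (n + 1) else d (n + 1) := by
  unfold weight
  rw [Finset.prod_Ico_succ_top (by omega : 1 ≤ n + 1)]
  congr 1
  · exact Finset.prod_congr rfl fun i hi => by simp only [entry_insertLast_lt_iff j σ hi]
  · have h1 : entry (insertLast j σ) (n + 1) = (j.succAbove (σ (Fin.last n)) : ℕ) + 1 := by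
      rw [← insertLast_castSucc, ← entry_succ]; rfl
    have h2 : entry (insertLast j σ) (n + 1 + 1) = (j : ℕ) + 1 := by
      conv_rhs => rw [← insertLast_last j σ]
      rw [← entry_succ]; rfl
    rw [h1, h2]
    simp only [add_lt_add_iff_right, Fin.val_fin_lt, Fin.succAbove_lt_iff_castSucc_lt]
    rfl

/-- The sum of the weights of the permutations of `n + 1` letters with last value `j`. -/
def lastSum {R : Type*} [CommRing R] (u d : ℕ → R) (n j : ℕ) : R :=
  ∑ π : Equiv.Perm (Fin (n + 1)), if (π (Fin.last n) : ℕ) = j then weight u d π else 0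

lemma sum_lastSum_mul {R : Type*} [CommRing R] (u d : ℕ → R) (n : ℕ) (f : ℕ → R) :
    ∑ j ∈ Finset.range (n + 1), lastSum u d n j * f j =
      ∑ π : Equiv.Perm (Fin (n + 1)), weight u d π * f (π (Fin.last n)) := by
  simp only [lastSum, Finset.sum_mul]
  rw [Finset.sum_comm]
  refine Finset.sum_congr rfl fun π _ => ?_
  simp only [ite_mul, zero_mul]
  rw [Finset.sum_ite_eq, if_pos (Finset.mem_range.2 (Fin.is_lt _))]

lemma sum_lastSum {R : Type*} [CommRing R] (u d : ℕ → R) (n : ℕ) :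
    ∑ j ∈ Finset.range (n + 1), lastSum u d n j = weightSum u d (n + 1) := by
  simpa [weightSum] using sum_lastSum_mul u d n fun _ => 1

/-- Removing the last letter `j` leaves a permutation whose own last value `i` decides the final
comparison: it is an ascent exactly when `i < j`. -/
lemma lastSum_succ {R : Type*} [CommRing R] (u d : ℕ → R) (n : ℕ) {j : ℕ} (hj : j < n + 2) :
    lastSum u d (n + 1) j = d (n + 1) * weightSum u d (n + 1) +
      (u (n + 1) - d (n + 1)) * ∑ i ∈ Finset.range j, lastSum u d n i := by
  have h1 : lastSum u d (n + 1) j = ∑ i ∈ Finset.range (n + 1),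
      lastSum u d n i * if i < j then u (n + 1) else d (n + 1) := by
    rw [sum_lastSum_mul u d n fun i => if i < j then u (n + 1) else d (n + 1), lastSum,
      sum_perm_succ, Finset.sum_eq_single (⟨j, hj⟩ : Fin (n + 2))]
    · simp [weight_insertLast]
    · intro b _ hb
      refine Finset.sum_eq_zero fun σ _ => ?_
      rw [insertLast_last, if_neg fun h => hb (Fin.ext h)]
    · simp
  rw [h1, ← sum_lastSum, Finset.mul_sum]
  have h2 : ∑ i ∈ Finset.range j, lastSum u d n i =
      ∑ i ∈ Finset.range (n + 1), if i < j then lastSum u d n i else 0 := by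
    rw [← Finset.sum_filter]
    refine Finset.sum_congr ?_ fun _ _ => rfl
    ext i
    simp only [Finset.mem_filter, Finset.mem_range]
    omega
  rw [h2, Finset.mul_sum, ← Finset.sum_add_distrib]
  refine Finset.sum_congr rfl fun i _ => ?_
  split_ifs <;> ring

lemma sum_range_choose_cast {R : Type*} [CommRing R] (j m : ℕ) :
    ∑ i ∈ Finset.range j, (i.choose m : R) = j.choose (m + 1) := by
  induction j with
  | zero => simp
  | succ j ih =>
    rw [Finset.sum_range_succ, ih, Nat.choose_succ_succ]
    push_cast
    ring

/-- Iterating `lastSum_succ`: each partial summation raises the lower index of the binomials in `j`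
by one (hockey-stick identity), and each step adds a new constant term, `k = n`. -/
lemma lastSum_eq {R : Type*} [CommRing R] (u d : ℕ → R) (h0 : d 0 = 1) (n : ℕ) {j : ℕ}
    (hj : j < n + 1) :
    lastSum u d n j = ∑ k ∈ Finset.range (n + 1), (j.choose (n - k) : R) *
      (d k * weightSum u d k * ∏ i ∈ Finset.Ioc k n, (u i - d i)) := by
  induction n generalizing j with
  | zero =>
    obtain rfl : j = 0 := by omega
    simp [lastSum, weightSum, weight, h0]
  | succ n ih =>
    rw [lastSum_succ u d n hj, Finset.sum_range_succ _ (n + 1)]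
    rw [Finset.sum_congr rfl fun i hi => ih (j := i) (by
      have := Finset.mem_range.1 hi
      omega), Finset.sum_comm, Finset.mul_sum, add_comm]
    congr 1
    · refine Finset.sum_congr rfl fun k hk => ?_
      have hk' : k ≤ n := Nat.lt_succ_iff.1 (Finset.mem_range.1 hk)
      rw [← Finset.sum_mul, sum_range_choose_cast, Finset.prod_Ioc_succ_top hk',
        show n + 1 - k = n - k + 1 by omega]
      ring
    · simp

/-- Conditioning on the last maximal increasing run after inclusion-exclusion. -/
lemma weightSum_succ {R : Type*} [CommRing R] (u d : ℕ → R) (h0 : d 0 = 1) (n : ℕ) :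
    weightSum u d (n + 1) = ∑ k ∈ Finset.range (n + 1), ((n + 1).choose k : R) *
      (d k * weightSum u d k * ∏ i ∈ Finset.Ioc k n, (u i - d i)) := by
  rw [← sum_lastSum, Finset.sum_congr rfl fun j hj => lastSum_eq u d h0 n (Finset.mem_range.1 hj),
    Finset.sum_comm]
  refine Finset.sum_congr rfl fun k hk => ?_
  have hk' : k ≤ n := Nat.lt_succ_iff.1 (Finset.mem_range.1 hk)
  rw [← Finset.sum_mul, sum_range_choose_cast, show n - k + 1 = n + 1 - k by omega,
    Nat.choose_symm (by omega)]

/-! ### A quadratic identity for the generating function -/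

/-- If `u n * b n = d n * ∑ k, n.choose k * b k`, where the ratio `u n / d n` is `q ^ n` for even `n`
and `q ^ (-n)` for odd `n`, then the exponential generating function `β` of `b` satisfies
`(β(qz) + β(-qz)) ^ 2 + (β(z) - β(-z)) ^ 2 = 4 * b 0 ^ 2`; here are the higher coefficients. -/
lemma coeff_rescale_sq_add_sq {K : Type*} [Field K] [CharZero K] {q : K}
    (hq : ∀ n : ℕ, 1 ≤ n → q ^ n ≠ 1) (β : PowerSeries K)
    (heven : ∀ n, Even n →
      q ^ n * PowerSeries.coeff n β = PowerSeries.coeff n (PowerSeries.exp K * β))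
    (hodd : ∀ n, Odd n →
      PowerSeries.coeff n β = q ^ n * PowerSeries.coeff n (PowerSeries.exp K * β))
    {n : ℕ} (hn : 1 ≤ n) :
    PowerSeries.coeff n ((PowerSeries.rescale q (β + PowerSeries.rescale (-1) β)) ^ 2 +
      (β - PowerSeries.rescale (-1) β) ^ 2) = 0 := by
  set ε := PowerSeries.exp K
  set ε' := PowerSeries.rescale (-1 : K) ε
  set β' := PowerSeries.rescale (-1 : K) β
  have hε : ε * ε' = 1 := by
    have := PowerSeries.exp_mul_exp_neg_eq_one (A := K)
    simpa [PowerSeries.evalNegHom] using this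
  have h1 : PowerSeries.rescale q (β + β') = ε * β + ε' * β' := by
    rw [← map_mul]
    ext k
    simp only [PowerSeries.coeff_rescale, map_add]
    rcases Nat.even_or_odd k with hk | hk
    · rw [hk.neg_one_pow, ← heven k hk]
      simp only [β', PowerSeries.coeff_rescale, hk.neg_one_pow]
      ring
    · simp only [β', PowerSeries.coeff_rescale, hk.neg_one_pow]
      ring
  have h2 : β - β' = PowerSeries.rescale q (ε * β - ε' * β') := by
    rw [← map_mul]
    ext k
    simp only [PowerSeries.coeff_rescale, map_sub]
    rcases Nat.even_or_odd k with hk | hk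
    · simp only [β', PowerSeries.coeff_rescale, hk.neg_one_pow]
      ring
    · simp only [β', PowerSeries.coeff_rescale, hk.neg_one_pow]
      rw [hodd k hk]
      ring
  -- Sum squared minus difference squared is four times the product, and `ε * β` and `ε' * β'` have
  -- the same product as `β` and `β'`.
  have h3 : (ε * β + ε' * β') ^ 2 + (β - β') ^ 2 = (β + β') ^ 2 + (ε * β - ε' * β') ^ 2 := by
    linear_combination 4 * β * β' * hε
  -- The series is invariant under `z ↦ q z`, so its coefficients of positive degree vanish.
  have h4 : PowerSeries.rescale q ((β + β') ^ 2 + (ε * β - ε' * β') ^ 2) =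
      (β + β') ^ 2 + (ε * β - ε' * β') ^ 2 := by
    rw [map_add, map_pow, map_pow, h1, ← h2, h3]
  rw [h1, h3]
  have h5 := congrArg (PowerSeries.coeff n) h4
  rw [PowerSeries.coeff_rescale] at h5
  have h6 : (q ^ n - 1) *
      PowerSeries.coeff n ((β + β') ^ 2 + (ε * β - ε' * β') ^ 2) = 0 := by
    linear_combination h5
  exact (mul_eq_zero.1 h6).resolve_left (sub_ne_zero.2 (hq n hn))

/-- Under the hypotheses of `coeff_rescale_sq_add_sq` with constant coefficient `1`, a subring that
contains the odd coefficients whenever it contains the earlier ones contains all coefficients. -/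
lemma coeff_mem_subring {K : Type*} [Field K] [CharZero K] {q : K}
    (hq : ∀ n : ℕ, 1 ≤ n → q ^ n ≠ 1) (β : PowerSeries K)
    (heven : ∀ n, Even n →
      q ^ n * PowerSeries.coeff n β = PowerSeries.coeff n (PowerSeries.exp K * β))
    (hodd : ∀ n, Odd n →
      PowerSeries.coeff n β = q ^ n * PowerSeries.coeff n (PowerSeries.exp K * β))
    (hzero : PowerSeries.coeff 0 β = 1) (O : Subring K) (hq0 : q ≠ 0) (hqO : q ∈ O) (hqinv : q⁻¹ ∈ O)
    (hrat : ∀ r : ℚ, (r : K) ∈ O) (hO : ∀ n : ℕ, Odd n → (1 - q ^ n)⁻¹ ∈ O) (n : ℕ) :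
    PowerSeries.coeff n β ∈ O := by
  induction n using Nat.strong_induction_on with
  | _ n ih =>
  rcases Nat.eq_zero_or_pos n with rfl | hn
  · rw [hzero]; exact O.one_mem
  rcases Nat.even_or_odd n with hk | hk
  -- For even `n`, the new coefficient enters only through the pairs `(0, n)` and `(n, 0)`, each
  -- contributing `4 * q ^ n`; no division by `1 - q ^ n` is needed.
  · have h := coeff_rescale_sq_add_sq hq β heven hodd hn
    set R : K := ∑ p ∈ (Finset.HasAntidiagonal.antidiagonal n).filter (fun p => p.1 ≠ 0 ∧ p.2 ≠ 0),
      (q ^ p.1 * (1 + (-1) ^ p.1) * (q ^ p.2 * (1 + (-1) ^ p.2)) +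
        (1 - (-1) ^ p.1) * (1 - (-1) ^ p.2)) *
        (PowerSeries.coeff p.1 β * PowerSeries.coeff p.2 β) with hR
    have hRO : R ∈ O := by
      refine O.sum_mem fun p hp => ?_
      obtain ⟨hp, h1, h2⟩ := Finset.mem_filter.1 hp
      have hp := Finset.HasAntidiagonal.mem_antidiagonal.1 hp
      have hm : (-1 : K) ∈ O := O.neg_mem O.one_mem
      refine O.mul_mem (O.add_mem (O.mul_mem (O.mul_mem (O.pow_mem hqO _) ?_)
        (O.mul_mem (O.pow_mem hqO _) ?_)) (O.mul_mem ?_ ?_))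
        (O.mul_mem (ih _ (by omega)) (ih _ (by omega)))
      · exact O.add_mem O.one_mem (O.pow_mem hm _)
      · exact O.add_mem O.one_mem (O.pow_mem hm _)
      · exact O.sub_mem O.one_mem (O.pow_mem hm _)
      · exact O.sub_mem O.one_mem (O.pow_mem hm _)
    have hsum : 8 * (q ^ n * PowerSeries.coeff n β) + R = 0 := by
      rw [← h, sq, sq, map_add, PowerSeries.coeff_mul, PowerSeries.coeff_mul,
        ← Finset.sum_add_distrib,
        ← Finset.sum_filter_add_sum_filter_not _ (fun p : ℕ × ℕ => p.1 ≠ 0 ∧ p.2 ≠ 0), add_comm]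
      congr 1
      · rw [hR]
        refine Finset.sum_congr rfl fun p _ => ?_
        simp only [PowerSeries.coeff_rescale, map_add, map_sub]
        ring
      · have : (Finset.HasAntidiagonal.antidiagonal n).filter (fun p : ℕ × ℕ => ¬(p.1 ≠ 0 ∧ p.2 ≠ 0)) =
            {(0, n), (n, 0)} := by
          ext ⟨a, b⟩
          simp only [Finset.mem_filter, Finset.HasAntidiagonal.mem_antidiagonal, Finset.mem_insert,
            Finset.mem_singleton, Prod.mk.injEq]
          omega
        rw [this, Finset.sum_pair (by simp; omega)]
        simp only [PowerSeries.coeff_rescale, map_add, map_sub, hk.neg_one_pow, hzero]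
        ring
    have : PowerSeries.coeff n β = ((-1 / 8 : ℚ) : K) * ((q⁻¹) ^ n * R) := by
      have h8 : R = -(8 * (q ^ n * PowerSeries.coeff n β)) := by linear_combination hsum
      rw [h8]
      push_cast
      rw [inv_pow]
      field_simp
    rw [this]
    exact O.mul_mem (hrat _) (O.mul_mem (O.pow_mem hqinv _) hRO)
  -- For odd `n`, moving the top term `q ^ n * coeff n β` to the left leaves the factor `1 - q ^ n`.
  · have h := hodd n hk
    rw [PowerSeries.coeff_mul, Finset.Nat.sum_antidiagonal_eq_sum_range_succ_mk,
      Finset.sum_range_succ'] at h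
    simp only [PowerSeries.coeff_exp, Nat.sub_zero, Nat.factorial_zero] at h
    have hne : 1 - q ^ n ≠ 0 := sub_ne_zero.2 (hq n hn).symm
    have : PowerSeries.coeff n β = (1 - q ^ n)⁻¹ * (q ^ n *
        ∑ i ∈ Finset.range n, algebraMap ℚ K (1 / ((i + 1).factorial : ℚ)) *
          PowerSeries.coeff (n - (i + 1)) β) := by
      rw [eq_inv_mul_iff_mul_eq₀ hne]
      simp only [Nat.cast_one, div_one, map_one, one_mul] at h
      linear_combination h
    rw [this]
    refine O.mul_mem (hO n hk) (O.mul_mem (O.pow_mem hqO _) (O.sum_mem fun i hi => ?_))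
    refine O.mul_mem ?_ (ih _ (by omega))
    rw [eq_ratCast]
    exact hrat _

/-! ### The weights of the alternating major index -/

/-- The weight of an ascent at `i` in the generating function of the alternating major index. -/
def ascentWeight {R : Type*} [CommRing R] (q : R) (i : ℕ) : R := if Even i then q ^ i else 1

/-- The weight of a descent at `i` in the generating function of the alternating major index. -/
def descentWeight {R : Type*} [CommRing R] (q : R) (i : ℕ) : R := if Even i then 1 else q ^ i

lemma ascentWeight_sub_descentWeight {R : Type*} [CommRing R] (q : R) (i : ℕ) :
    ascentWeight q i - descentWeight q i = (-1) ^ (i + 1) * (1 - q ^ i) := by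
  unfold ascentWeight descentWeight
  split_ifs with h
  · rw [pow_succ, h.neg_one_pow]; ring
  · rw [pow_succ, (Nat.not_even_iff_odd.1 h).neg_one_pow]; ring

/-- `∑ π, q ^ altmaj π` as a weighted sum over permutations. -/
def altmajSum {R : Type*} [CommRing R] (q : R) (n : ℕ) : R :=
  weightSum (ascentWeight q) (descentWeight q) n

lemma map_altmajSum {R S : Type*} [CommRing R] [CommRing S] (φ : R →+* S) (q : R) (n : ℕ) :
    φ (altmajSum q n) = altmajSum (φ q) n := by
  simp [altmajSum, weightSum, weight, ascentWeight, descentWeight, map_sum, map_prod, apply_ite φ]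

section Recursion

variable {K : Type*} [Field K]

/-- The weighted sum divided by `± ∏ i ∈ Ioc 0 n, (1 - q ^ i)`. -/
def normalizedSum (q : K) (n : ℕ) : K :=
  descentWeight q n * altmajSum q n /
    ∏ i ∈ Finset.Ioc 0 n, (ascentWeight q i - descentWeight q i)

lemma prod_ascentWeight_sub_ne_zero {q : K} (hq : ∀ n : ℕ, 1 ≤ n → q ^ n ≠ 1) (m n : ℕ) :
    ∏ i ∈ Finset.Ioc m n, (ascentWeight q i - descentWeight q i) ≠ 0 := by
  refine Finset.prod_ne_zero_iff.2 fun i hi => ?_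
  rw [ascentWeight_sub_descentWeight]
  have := (Finset.mem_Ioc.1 hi).1
  exact mul_ne_zero (by simp) (sub_ne_zero.2 (hq i (by omega)).symm)

lemma altmajSum_zero {R : Type*} [CommRing R] (q : R) : altmajSum q 0 = 1 := by
  simp [altmajSum, weightSum, weight]

lemma ascentWeight_mul_normalizedSum {q : K} (hq : ∀ n : ℕ, 1 ≤ n → q ^ n ≠ 1) (n : ℕ) :
    ascentWeight q n * normalizedSum q n = descentWeight q n *
      ∑ k ∈ Finset.range (n + 1), (n.choose k : K) * normalizedSum q k := by
  cases n with
  | zero => simp [ascentWeight, descentWeight]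
  | succ n =>
    have hP := prod_ascentWeight_sub_ne_zero hq 0 n
    have h1 : altmajSum q (n + 1) = (∏ i ∈ Finset.Ioc 0 n, (ascentWeight q i - descentWeight q i)) *
        ∑ k ∈ Finset.range (n + 1), ((n + 1).choose k : K) * normalizedSum q k := by
      rw [altmajSum, weightSum_succ _ _ (by simp [descentWeight]), Finset.mul_sum]
      refine Finset.sum_congr rfl fun k hk => ?_
      have hk' : k ≤ n := Nat.lt_succ_iff.1 (Finset.mem_range.1 hk)
      rw [← Finset.prod_Ioc_consecutive _ (Nat.zero_le k) hk', normalizedSum, altmajSum]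
      have := prod_ascentWeight_sub_ne_zero hq 0 k
      field_simp
    have h2 : (ascentWeight q (n + 1) - descentWeight q (n + 1)) * normalizedSum q (n + 1) =
        descentWeight q (n + 1) *
          ∑ k ∈ Finset.range (n + 1), ((n + 1).choose k : K) * normalizedSum q k := by
      have hP' := prod_ascentWeight_sub_ne_zero hq 0 (n + 1)
      rw [Finset.prod_Ioc_succ_top (Nat.zero_le n)] at hP'
      have h3 := right_ne_zero_of_mul hP'
      conv_lhs => rw [normalizedSum, h1, Finset.prod_Ioc_succ_top (Nat.zero_le n)]
      field_simp
    -- Adding the missing term `k = n + 1` to both sides of `h2` turns the factor `u - d` on the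
    -- left into `u`.
    rw [Finset.sum_range_succ, Nat.choose_self]
    push_cast
    linear_combination h2

lemma normalizedSum_mem_subring [CharZero K] {q : K} (hq : ∀ n : ℕ, 1 ≤ n → q ^ n ≠ 1)
    (hq0 : q ≠ 0) (O : Subring K) (hqO : q ∈ O) (hqinv : q⁻¹ ∈ O)
    (hrat : ∀ r : ℚ, (r : K) ∈ O) (hO : ∀ n : ℕ, Odd n → (1 - q ^ n)⁻¹ ∈ O) (n : ℕ) :
    normalizedSum q n ∈ O := by
  set β : PowerSeries K := PowerSeries.mk fun n => normalizedSum q n / n.factorial with hβ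
  have hfac : ∀ k : ℕ, (k.factorial : K) ≠ 0 := fun k => Nat.cast_ne_zero.2 k.factorial_ne_zero
  have hcoeff : ∀ m, PowerSeries.coeff m (PowerSeries.exp K * β) =
      (∑ k ∈ Finset.range (m + 1), (m.choose k : K) * normalizedSum q k) / m.factorial := by
    intro m
    rw [mul_comm, PowerSeries.coeff_mul, Finset.Nat.sum_antidiagonal_eq_sum_range_succ_mk,
      Finset.sum_div]
    refine Finset.sum_congr rfl fun k hk => ?_
    have hk' : k ≤ m := Nat.lt_succ_iff.1 (Finset.mem_range.1 hk)
    rw [hβ, PowerSeries.coeff_mk, PowerSeries.coeff_exp, Nat.cast_choose K hk', eq_ratCast]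
    push_cast
    have h1 := hfac k
    have h2 := hfac m
    have h3 := hfac (m - k)
    field_simp
  have hmem : PowerSeries.coeff n β ∈ O := by
    refine coeff_mem_subring hq β ?_ ?_ ?_ O hq0 hqO hqinv hrat hO n
    · intro m hm
      have := ascentWeight_mul_normalizedSum hq m
      simp only [ascentWeight, descentWeight, if_pos hm, one_mul] at this
      rw [hcoeff, ← this, hβ, PowerSeries.coeff_mk]
      ring
    · intro m hm
      have := ascentWeight_mul_normalizedSum hq m
      simp only [ascentWeight, descentWeight, if_neg (Nat.not_even_iff_odd.2 hm), one_mul] at this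
      rw [hcoeff, hβ, PowerSeries.coeff_mk, this]
      ring
    · simp [hβ, normalizedSum, descentWeight, altmajSum_zero]
  have : normalizedSum q n = ((n.factorial : ℚ) : K) * PowerSeries.coeff n β := by
    rw [hβ, PowerSeries.coeff_mk]
    push_cast
    rw [mul_div_cancel₀ _ (hfac n)]
  rw [this]
  exact O.mul_mem (hrat _) hmem

end Recursion

/-! ### Denominators coprime to every `1 + X ^ j` -/

/-- A polynomial that is coprime to all `1 + X ^ j` with `j ≥ 1`. -/
def CoprimeToOneAddPow (g : ℚ[X]) : Prop := ∀ j : ℕ, 1 ≤ j → IsCoprime g (1 + X ^ j)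

lemma CoprimeToOneAddPow.mul {g h : ℚ[X]} (hg : CoprimeToOneAddPow g)
    (hh : CoprimeToOneAddPow h) : CoprimeToOneAddPow (g * h) :=
  fun j hj => (hg j hj).mul_left (hh j hj)

lemma coprimeToOneAddPow_one : CoprimeToOneAddPow 1 := fun _ _ => isCoprime_one_left

lemma coprimeToOneAddPow_X : CoprimeToOneAddPow X := fun j hj => by
  obtain ⟨k, rfl⟩ : ∃ k, j = k + 1 := ⟨j - 1, by omega⟩
  exact ⟨-X ^ k, 1, by ring⟩

/-- `X ^ (n * j)` is `1` modulo the first polynomial and `(-1) ^ n = -1` modulo the second, so the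
ideal they generate contains the unit `2`. -/
lemma coprimeToOneAddPow_one_sub_pow {n : ℕ} (hn : Odd n) :
    CoprimeToOneAddPow (1 - X ^ n) := fun j _ => by
  obtain ⟨a, ha⟩ : (1 - X ^ n : ℚ[X]) ∣ 1 - X ^ (n * j) := by
    simpa [pow_mul] using sub_dvd_pow_sub_pow (1 : ℚ[X]) (X ^ n) j
  obtain ⟨b, hb⟩ : (1 + X ^ j : ℚ[X]) ∣ 1 + X ^ (n * j) := by
    simpa [mul_comm n j, pow_mul] using hn.add_dvd_pow_add_pow (1 : ℚ[X]) (X ^ j)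
  have h2 : (C (1 / 2 : ℚ) : ℚ[X]) * 2 = 1 := by
    rw [← C_ofNat, ← C_mul]; norm_num
  exact ⟨C (1 / 2) * a, C (1 / 2) * b, by
    linear_combination (-C (1 / 2 : ℚ)) * ha - C (1 / 2 : ℚ) * hb + h2⟩

/-- The fractions whose denominator is coprime to all `1 + X ^ j` with `j ≥ 1`. -/
def coprimeFractions : Subring (FractionRing ℚ[X]) where
  carrier := {x | ∃ f g : ℚ[X], CoprimeToOneAddPow g ∧
    x * algebraMap _ (FractionRing ℚ[X]) g = algebraMap _ (FractionRing ℚ[X]) f}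
  mul_mem' := by
    rintro x y ⟨f, g, hg, hx⟩ ⟨f', g', hg', hy⟩
    refine ⟨f * f', g * g', hg.mul hg', ?_⟩
    rw [map_mul, map_mul, ← hx, ← hy]; ring
  one_mem' := ⟨1, 1, coprimeToOneAddPow_one, by simp⟩
  add_mem' := by
    rintro x y ⟨f, g, hg, hx⟩ ⟨f', g', hg', hy⟩
    refine ⟨f * g' + f' * g, g * g', hg.mul hg', ?_⟩
    rw [map_mul, map_add, map_mul, map_mul, ← hx, ← hy]; ring
  zero_mem' := ⟨0, 1, coprimeToOneAddPow_one, by simp⟩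
  neg_mem' := by
    rintro x ⟨f, g, hg, hx⟩
    exact ⟨-f, g, hg, by rw [map_neg, ← hx]; ring⟩

lemma mem_coprimeFractions {x : FractionRing ℚ[X]} : x ∈ coprimeFractions ↔
    ∃ f g : ℚ[X], CoprimeToOneAddPow g ∧
      x * algebraMap _ (FractionRing ℚ[X]) g = algebraMap _ (FractionRing ℚ[X]) f := Iff.rfl

lemma algebraMap_mem_coprimeFractions (f : ℚ[X]) :
    algebraMap _ (FractionRing ℚ[X]) f ∈ coprimeFractions :=
  ⟨f, 1, coprimeToOneAddPow_one, by simp⟩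

lemma inv_algebraMap_mem_coprimeFractions {g : ℚ[X]} (h0 : g ≠ 0) (hg : CoprimeToOneAddPow g) :
    (algebraMap _ (FractionRing ℚ[X]) g)⁻¹ ∈ coprimeFractions :=
  ⟨1, g, hg, by
    rw [inv_mul_cancel₀, map_one]
    simpa using h0⟩

lemma X_pow_ne_one {n : ℕ} (hn : 1 ≤ n) : (X : ℚ[X]) ^ n ≠ 1 := fun h => by
  have := congrArg natDegree h
  simp at this
  omega

/-- `∑ π, q ^ altmaj π` is `∏ i ∈ Ioc 0 n, (1 - q ^ i)` times a fraction whose denominator is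
coprime to all `1 + q ^ j`. -/
lemma exists_prod_dvd_mul_altmajSum (n : ℕ) : ∃ g : ℚ[X], CoprimeToOneAddPow g ∧
    ∏ i ∈ Finset.Ioc 0 n, (1 - X ^ i) ∣ g * altmajSum (X : ℚ[X]) n := by
  set φ := algebraMap ℚ[X] (FractionRing ℚ[X])
  have hφ : Function.Injective φ := IsFractionRing.injective _ _
  have hq : ∀ n : ℕ, 1 ≤ n → φ X ^ n ≠ 1 := fun n hn h => by
    rw [← map_pow, ← map_one φ] at h
    exact X_pow_ne_one hn (hφ h)
  have hmem := normalizedSum_mem_subring hq ((map_ne_zero_iff φ hφ).2 X_ne_zero)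
    coprimeFractions (algebraMap_mem_coprimeFractions X)
    (inv_algebraMap_mem_coprimeFractions X_ne_zero coprimeToOneAddPow_X)
    (fun r => by
      have : (r : FractionRing ℚ[X]) = φ (C r) := by
        rw [← eq_ratCast ((φ.comp C : ℚ →+* FractionRing ℚ[X])) r]; rfl
      rw [this]
      exact algebraMap_mem_coprimeFractions _)
    (fun m hm => by
      rw [← map_pow, ← map_one φ, ← map_sub]
      exact inv_algebraMap_mem_coprimeFractions
        (sub_ne_zero.2 (X_pow_ne_one hm.pos).symm) (coprimeToOneAddPow_one_sub_pow hm)) n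
  obtain ⟨f, g, hg, h⟩ := mem_coprimeFractions.1 hmem
  change normalizedSum (φ X) n * φ g = φ f at h
  have hdesc : CoprimeToOneAddPow (descentWeight X n) := by
    unfold descentWeight
    split_ifs
    · exact coprimeToOneAddPow_one
    · exact fun j hj => (coprimeToOneAddPow_X j hj).pow_left
  refine ⟨g * descentWeight X n, hg.mul hdesc, ?_⟩
  have hP := prod_ascentWeight_sub_ne_zero hq 0 n
  have hd : φ (descentWeight X n) = descentWeight (φ X) n := by
    simp [descentWeight, apply_ite φ]
  have hprod : φ (∏ i ∈ Finset.Ioc 0 n, ((-1) ^ (i + 1) * (1 - X ^ i))) =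
      ∏ i ∈ Finset.Ioc 0 n, (ascentWeight (φ X) i - descentWeight (φ X) i) := by
    simp [ascentWeight_sub_descentWeight]
  have key : g * descentWeight X n * altmajSum X n =
      (∏ i ∈ Finset.Ioc 0 n, ((-1) ^ (i + 1) * (1 - X ^ i))) * f := by
    apply hφ
    rw [map_mul, map_mul, map_mul, ← h, hprod, hd, map_altmajSum, normalizedSum]
    field_simp
  rw [key, Finset.prod_mul_distrib]
  exact (dvd_mul_left _ _).mul_right _

/-- Coprimality cancels the denominator over `ℚ`; since `F` is monic, divisibility descends to
`ℤ[X]`. -/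
lemma dvd_altmajSum {F : ℤ[X]} (hF : F.Monic) {n : ℕ}
    (hdvd : F ∣ ∏ i ∈ Finset.Ioc 0 n, (1 - X ^ i))
    (hco : ∀ g : ℚ[X], CoprimeToOneAddPow g → IsCoprime g (F.map (Int.castRingHom ℚ))) :
    F ∣ altmajSum X n := by
  rw [← map_dvd_map (Int.castRingHom ℚ) Int.cast_injective hF]
  obtain ⟨g, hg, h⟩ := exists_prod_dvd_mul_altmajSum n
  have h1 : (altmajSum (X : ℤ[X]) n).map (Int.castRingHom ℚ) = altmajSum (X : ℚ[X]) n := by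
    rw [← coe_mapRingHom, map_altmajSum]; simp
  have h2 : F.map (Int.castRingHom ℚ) ∣ ∏ i ∈ Finset.Ioc 0 n, (1 - X ^ i) := by
    have := Polynomial.map_dvd (Int.castRingHom ℚ) hdvd
    simpa [Polynomial.map_prod] using this
  rw [h1]
  exact (hco g hg).symm.dvd_of_dvd_mul_left (h2.trans h)

lemma entry_ne_entry_succ {n : ℕ} (π : Equiv.Perm (Fin n)) {i : ℕ} (hi : i ∈ Finset.Ico 1 n) :
    entry π i ≠ entry π (i + 1) := by
  obtain ⟨h1, h2⟩ := Finset.mem_Ico.1 hi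
  obtain ⟨k, rfl⟩ : ∃ k, i = k + 1 := ⟨i - 1, by omega⟩
  have e1 := entry_succ π ⟨k, by omega⟩
  have e2 := entry_succ π ⟨k + 1, by omega⟩
  simp only at e1 e2
  rw [e1, e2]
  intro h
  have := π.injective (Fin.ext (Nat.succ_injective h))
  simp at this

lemma pow_altmaj {R : Type*} [CommRing R] (q : R) {n : ℕ} (π : Equiv.Perm (Fin n)) :
    q ^ altmaj π = weight (ascentWeight q) (descentWeight q) π := by
  rw [altmaj, ← Finset.prod_pow_eq_pow_sum, altDescents, Finset.prod_filter, weight]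
  refine Finset.prod_congr rfl fun i hi => ?_
  have := entry_ne_entry_succ π hi
  unfold ascentWeight descentWeight
  rcases Nat.even_or_odd i with hk | hk
  · have := Nat.not_odd_iff_even.2 hk
    simp only [hk, this, true_and, false_and, or_false, if_true]
  · have h2 := Nat.not_even_iff_odd.2 hk
    simp only [hk, h2, true_and, false_and, false_or, if_false]
    split_ifs <;> first | rfl | omega

lemma altmajSum_eq_sum {R : Type*} [CommRing R] (q : R) (n : ℕ) :
    altmajSum q n = ∑ π : Equiv.Perm (Fin n), q ^ altmaj π :=
  (Finset.sum_congr rfl fun π _ => pow_altmaj q π).symm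

lemma eval_one_altPoly (n : ℕ) :
    (altPoly n).eval 1 = ∑ π : Equiv.Perm (Fin n), (X : ℤ[X]) ^ altmaj π := by
  simp [altPoly, eval_finsetSum]

/-! ### The two families of divisors -/

/-- `∏ i ∈ Icc 1 n, (1 + X ^ i)` over the halves, quarters, ... of `n`, with `L` factors. -/
noncomputable def dyadicProd (n L : ℕ) : ℤ[X] :=
  ∏ k ∈ Finset.Icc 1 L, ∏ i ∈ Finset.Icc 1 (n / 2 ^ k), (1 + X ^ i)

lemma dyadicProd_succ (n L : ℕ) :
    dyadicProd n (L + 1) = (∏ i ∈ Finset.Icc 1 (n / 2), (1 + X ^ i)) * dyadicProd (n / 2) L := by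
  unfold dyadicProd
  rw [← Finset.mul_prod_Ioc_eq_prod_Icc (by omega : 1 ≤ L + 1), pow_one]
  congr 1
  rw [show Finset.Ioc 1 (L + 1) = (Finset.Icc 1 L).map (addRightEmbedding 1) by
    rw [Finset.map_add_right_Icc]; ext; simp [Finset.mem_Icc, Finset.mem_Ioc]; omega,
    Finset.prod_map]
  refine Finset.prod_congr rfl fun k _ => ?_
  rw [addRightEmbedding_apply, pow_succ', Nat.div_div_eq_div_mul]

lemma prod_mul_dvd_prod {R : Type*} [CommRing R] (f : ℕ → R) (n : ℕ) {c : ℕ} (hc : 1 ≤ c) :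
    ∏ j ∈ Finset.Icc 1 (n / c), f (c * j) ∣ ∏ i ∈ Finset.Ioc 0 n, f i := by
  rw [← Finset.prod_image (s := Finset.Icc 1 (n / c)) (g := fun j => c * j) (f := f)
    fun a _ b _ h => Nat.eq_of_mul_eq_mul_left hc h]
  refine Finset.prod_dvd_prod_of_subset _ _ _ fun i hi => ?_
  obtain ⟨j, hj, rfl⟩ := Finset.mem_image.1 hi
  obtain ⟨h1, h2⟩ := Finset.mem_Icc.1 hj
  rw [Nat.le_div_iff_mul_le hc, mul_comm] at h2
  exact Finset.mem_Ioc.2 ⟨Nat.mul_pos hc h1, h2⟩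

/-- Each even-index factor splits as `1 - X ^ (2 * i) = (1 - X ^ i) * (1 + X ^ i)`; the factors `1 -
X ^ i` with `i ≤ n / 2` feed the next dyadic level. -/
lemma dyadicProd_dvd (n L : ℕ) :
    dyadicProd n L ∣ ∏ i ∈ Finset.Ioc 0 n, ((1 : ℤ[X]) - X ^ i) := by
  induction L generalizing n with
  | zero => simp [dyadicProd]
  | succ L ih =>
    rw [dyadicProd_succ]
    refine (mul_dvd_mul_left _ (ih (n / 2))).trans ?_
    refine dvd_trans (dvd_of_eq ?_) (prod_mul_dvd_prod (fun i => (1 : ℤ[X]) - X ^ i) n one_le_two)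
    rw [show Finset.Ioc 0 (n / 2) = Finset.Icc 1 (n / 2) from rfl, ← Finset.prod_mul_distrib]
    refine Finset.prod_congr rfl fun i _ => ?_
    rw [two_mul, pow_add]
    ring

lemma monic_one_add_X_pow {R : Type*} [CommRing R] {i : ℕ} (hi : 1 ≤ i) :
    (1 + X ^ i : R[X]).Monic := by
  rw [add_comm, ← C_1]
  exact monic_X_pow_add_C 1 (by omega)

lemma monic_dyadicProd (n L : ℕ) : (dyadicProd n L).Monic :=
  monic_prod_of_monic _ _ fun _ _ => monic_prod_of_monic _ _ fun _ hi =>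
    monic_one_add_X_pow (Finset.mem_Icc.1 hi).1

lemma dyadicProd_dvd_altmajSum (n L : ℕ) : dyadicProd n L ∣ altmajSum X n := by
  refine dvd_altmajSum (monic_dyadicProd n L) (dyadicProd_dvd n L) fun g hg => ?_
  simp only [dyadicProd, Polynomial.map_prod, Polynomial.map_add, Polynomial.map_one,
    Polynomial.map_pow, Polynomial.map_X]
  exact IsCoprime.prod_right fun k _ => IsCoprime.prod_right fun i hi =>
    hg i (Finset.mem_Icc.1 hi).1

lemma one_add_pow_dvd_altmajSum (n : ℕ) {m : ℕ} (hm : 1 ≤ m) :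
    (1 + X ^ m : ℤ[X]) ^ (n / (2 * m)) ∣ altmajSum X n := by
  refine dvd_altmajSum ((monic_one_add_X_pow hm).pow _) ?_ fun g hg => ?_
  -- Each of the `n / (2 * m)` factors `1 - X ^ (2 * m * j)` supplies one copy of `1 + X ^ m`.
  · refine dvd_trans ?_
      (prod_mul_dvd_prod (fun i => (1 : ℤ[X]) - X ^ i) n (by omega : 1 ≤ 2 * m))
    have h : ∏ _j ∈ Finset.Icc 1 (n / (2 * m)), (1 + X ^ m : ℤ[X]) =
        (1 + X ^ m) ^ (n / (2 * m)) := by simp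
    rw [← h]
    refine Finset.prod_dvd_prod_of_dvd _ _ fun j _ => ?_
    have h1 : (1 - X ^ (2 * m) : ℤ[X]) ∣ 1 - X ^ (2 * m * j) := by
      simpa [pow_mul] using sub_dvd_pow_sub_pow (1 : ℤ[X]) (X ^ (2 * m)) j
    exact (Dvd.intro (1 - X ^ m) (by rw [two_mul, pow_add]; ring)).trans h1
  · simpa using (hg m hm).pow_right

/-! ### Complementation, constant term and palindromicity -/

section Palindromic

/-- The permutation with values `n + 1 - π_i`. -/
def complement {n : ℕ} (π : Equiv.Perm (Fin n)) : Equiv.Perm (Fin n) := π.trans Fin.revPerm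

lemma complement_involutive (n : ℕ) :
    Function.Involutive (complement : Equiv.Perm (Fin n) → Equiv.Perm (Fin n)) := fun π => by
  ext1 i
  simp [complement]

lemma entry_complement_lt_iff {n : ℕ} (π : Equiv.Perm (Fin n)) {i j : ℕ} (hi : 1 ≤ i) (hin : i ≤ n)
    (hj : 1 ≤ j) (hjn : j ≤ n) :
    entry (complement π) i < entry (complement π) j ↔ entry π j < entry π i := by
  simp only [entry, hi, hin, hj, hjn, and_self, dite_true, complement, Equiv.trans_apply,
    Fin.revPerm_apply, add_lt_add_iff_right, Fin.val_fin_lt, Fin.rev_lt_rev]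

lemma altDescents_complement {n : ℕ} (π : Equiv.Perm (Fin n)) :
    altDescents (complement π) = Finset.Ico 1 n \ altDescents π := by
  ext i
  simp only [altDescents, Finset.mem_sdiff, Finset.mem_filter, not_and]
  refine and_congr_right fun hi => ?_
  have hne := entry_ne_entry_succ π hi
  obtain ⟨h1, h2⟩ := Finset.mem_Ico.1 hi
  rw [entry_complement_lt_iff π h1 (by omega) (by omega) (by omega),
    entry_complement_lt_iff π (by omega) (by omega) h1 (by omega)]
  rcases Nat.even_or_odd i with hk | hk
  · have h3 := Nat.not_odd_iff_even.2 hk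
    simp only [hi, hk, h3, true_and, false_and, or_false, forall_const]
    omega
  · have h3 := Nat.not_even_iff_odd.2 hk
    simp only [hi, hk, h3, true_and, false_and, false_or, forall_const]
    omega

lemma altDescents_subset {n : ℕ} (π : Equiv.Perm (Fin n)) : altDescents π ⊆ Finset.Ico 1 n :=
  Finset.filter_subset _ _

lemma altmaj_complement {n : ℕ} (π : Equiv.Perm (Fin n)) :
    altmaj (complement π) + altmaj π = ∑ i ∈ Finset.Ico 1 n, i := by
  rw [altmaj, altDescents_complement]
  exact Finset.sum_sdiff (altDescents_subset π)

lemma altmaj_eq_zero_iff {n : ℕ} (π : Equiv.Perm (Fin n)) : altmaj π = 0 ↔ altDescents π = ∅ := by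
  rw [altmaj, Finset.sum_eq_zero_iff, Finset.eq_empty_iff_forall_notMem]
  refine forall_congr' fun i => ⟨fun h hi => ?_, fun h hi => (h hi).elim⟩
  have := (Finset.mem_Ico.1 (altDescents_subset π hi)).1
  have := h hi
  omega

lemma isDownUp_iff {n : ℕ} (π : Equiv.Perm (Fin n)) :
    IsDownUp π ↔ altDescents (complement π) = ∅ := by
  rw [altDescents_complement, Finset.sdiff_eq_empty_iff_subset, IsDownUp]
  refine forall₂_congr fun i hi => ?_
  rw [altDescents, Finset.mem_filter]
  rcases Nat.even_or_odd i with hk | hk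
  · simp [hi, hk]
  · simp [hi, hk]

lemma coeff_altmajSum (n k : ℕ) : (altmajSum (X : ℤ[X]) n).coeff k =
    (Finset.univ.filter fun π : Equiv.Perm (Fin n) => k = altmaj π).card := by
  simp [altmajSum_eq_sum, coeff_X_pow]

lemma coeff_zero_altmajSum (n : ℕ) : (altmajSum (X : ℤ[X]) n).coeff 0 = eulerNumber n := by
  classical
  rw [coeff_altmajSum, eulerNumber, Nat.card_eq_fintype_card, Fintype.card_subtype]
  congr 1
  refine Finset.card_bij' (fun π _ => complement π) (fun π _ => complement π) ?_ ?_
    (fun π _ => complement_involutive n π) (fun π _ => complement_involutive n π)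
  · intro π hπ
    simp only [Finset.mem_filter, Finset.mem_univ, true_and] at hπ ⊢
    rw [isDownUp_iff, complement_involutive, ← altmaj_eq_zero_iff, hπ]
  · intro π hπ
    simp only [Finset.mem_filter, Finset.mem_univ, true_and] at hπ ⊢
    exact ((altmaj_eq_zero_iff _).2 ((isDownUp_iff π).1 hπ)).symm

/-- At `q = 0` the weight is `0 ^ altmaj π`, so weight `1` detects `altmaj π = 0`. Such a
permutation is built by appending alternately a largest and a smallest value. -/
lemma exists_altmaj_eq_zero (n : ℕ) : ∃ π : Equiv.Perm (Fin n), altmaj π = 0 := by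
  suffices h : ∃ π : Equiv.Perm (Fin n), weight (ascentWeight (0 : ℤ)) (descentWeight 0) π = 1 by
    obtain ⟨π, hπ⟩ := h
    refine ⟨π, ?_⟩
    rw [← pow_altmaj] at hπ
    by_contra h
    simp [h] at hπ
  induction n with
  | zero => exact ⟨1, by simp [weight]⟩
  | succ n ih =>
    cases n with
    | zero => exact ⟨1, by simp [weight]⟩
    | succ n =>
      obtain ⟨σ, hσ⟩ := ih
      rcases Nat.even_or_odd (n + 1) with h | h
      · refine ⟨insertLast 0 σ, ?_⟩
        rw [weight_insertLast, hσ]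
        simp [descentWeight, h]
      · refine ⟨insertLast (Fin.last _) σ, ?_⟩
        rw [weight_insertLast, hσ, if_pos (by simp; omega)]
        simp [ascentWeight, Nat.not_even_iff_odd.2 h]

lemma coeff_zero_altmajSum_ne_zero (n : ℕ) : (altmajSum (X : ℤ[X]) n).coeff 0 ≠ 0 := by
  rw [coeff_altmajSum]
  obtain ⟨π, hπ⟩ := exists_altmaj_eq_zero n
  exact_mod_cast Finset.card_ne_zero_of_mem (by simpa using hπ.symm : π ∈ _)

/-- Complementation sends `altmaj` to `D - altmaj`. The nonzero constant term makes the degree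
exactly `D`, so `reverse` is reflection about `D / 2`. -/
lemma reverse_altmajSum (n : ℕ) : (altmajSum (X : ℤ[X]) n).reverse = altmajSum X n := by
  set D := ∑ i ∈ Finset.Ico 1 n, i
  have hsym : ∀ k ≤ D, (altmajSum (X : ℤ[X]) n).coeff (D - k) = (altmajSum (X : ℤ[X]) n).coeff k := by
    intro k hk
    rw [coeff_altmajSum, coeff_altmajSum]
    congr 1
    refine Finset.card_bij' (fun π _ => complement π) (fun π _ => complement π) ?_ ?_
      (fun π _ => complement_involutive n π) (fun π _ => complement_involutive n π)
    all_goals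
      intro π hπ
      have h : altmaj (complement π) + altmaj π = D := altmaj_complement π
      simp only [Finset.mem_filter, Finset.mem_univ, true_and] at hπ ⊢
      omega
  have hzero : ∀ k, D < k → (altmajSum (X : ℤ[X]) n).coeff k = 0 := by
    intro k hk
    rw [coeff_altmajSum, Nat.cast_eq_zero, Finset.card_eq_zero, Finset.filter_eq_empty_iff]
    intro π _ h
    have h : altmaj (complement π) + altmaj π = D := altmaj_complement π
    omega
  have hdeg : (altmajSum (X : ℤ[X]) n).natDegree = D := by
    refine le_antisymm (natDegree_le_iff_coeff_eq_zero.2 fun k hk => hzero k hk)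
      (le_natDegree_of_ne_zero ?_)
    have := hsym 0 (Nat.zero_le D)
    rw [Nat.sub_zero] at this
    rw [this]
    exact coeff_zero_altmajSum_ne_zero n
  ext k
  rw [coeff_reverse, hdeg]
  rcases le_or_gt k D with hk | hk
  · rw [revAt_le hk, hsym k hk]
  · rw [revAt_eq_self_of_lt hk]

lemma reverse_one_add_X_pow (i : ℕ) : (1 + X ^ i : ℤ[X]).reverse = 1 + X ^ i := by
  have hdeg : (1 + X ^ i : ℤ[X]).natDegree = i := by
    rw [add_comm, ← C_1, natDegree_X_pow_add_C]
  rw [reverse, hdeg, reflect_add, ← C_1, reflect_C, reflect_monomial]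
  simp [add_comm]

lemma reverse_prod_of_reverse_eq {ι : Type*} (s : Finset ι) (f : ι → ℤ[X])
    (hf : ∀ i ∈ s, (f i).reverse = f i) : (∏ i ∈ s, f i).reverse = ∏ i ∈ s, f i := by
  classical
  induction s using Finset.induction_on with
  | empty => rw [Finset.prod_empty, ← C_1, reverse_C]
  | insert a s ha ih =>
    rw [Finset.prod_insert ha, reverse_mul_of_domain, hf a (Finset.mem_insert_self a s),
      ih fun i hi => hf i (Finset.mem_insert_of_mem hi)]

lemma reverse_dyadicProd (n L : ℕ) : (dyadicProd n L).reverse = dyadicProd n L :=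
  reverse_prod_of_reverse_eq _ _ fun _ _ => reverse_prod_of_reverse_eq _ _ fun i _ =>
    reverse_one_add_X_pow i

lemma isPalindromic_of_reverse_eq {h : ℤ[X]} (hh : h.reverse = h) :
    IsPalindromic h h.natDegree := by
  refine ⟨le_rfl, fun i hi => ?_⟩
  conv_lhs => rw [← hh]
  rw [coeff_reverse, revAt_le (hi.trans (Nat.div_le_self _ _))]

end Palindromic

/-! ### Values at `0` and `1`, and the parity of the cofactor -/

lemma coeff_zero_dyadicProd (n L : ℕ) : (dyadicProd n L).coeff 0 = 1 := by
  rw [coeff_zero_eq_eval_zero, dyadicProd, eval_prod]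
  refine Finset.prod_eq_one fun k _ => ?_
  rw [eval_prod]
  refine Finset.prod_eq_one fun i hi => ?_
  have := (Finset.mem_Icc.1 hi).1
  simp only [eval_add, eval_one, eval_pow, eval_X]
  rw [zero_pow (by omega), add_zero]

lemma eval_one_dyadicProd (n L : ℕ) :
    (dyadicProd n L).eval 1 = 2 ^ (∑ k ∈ Finset.Icc 1 L, n / 2 ^ k) := by
  simp [dyadicProd, eval_prod, Finset.prod_pow_eq_pow_sum, one_add_one_eq_two]

lemma eval_one_altmajSum (n : ℕ) : (altmajSum (X : ℤ[X]) n).eval 1 = n.factorial := by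
  simp [altmajSum_eq_sum, eval_finsetSum, Fintype.card_perm]

/-- Legendre's formula for the prime two, as the oddness of the cofactor. -/
lemma odd_of_factorial_eq {n : ℕ} {e : ℤ}
    (h : (n.factorial : ℤ) = 2 ^ (∑ k ∈ Finset.Icc 1 (Nat.log 2 n), n / 2 ^ k) * e) : Odd e := by
  by_contra hodd
  obtain ⟨c, rfl⟩ := (Int.not_odd_iff_even.1 hodd).two_dvd
  set l := ∑ k ∈ Finset.Icc 1 (Nat.log 2 n), n / 2 ^ k with hl
  have hdvd : 2 ^ (l + 1) ∣ n.factorial := by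
    have : ((2 : ℤ) ^ (l + 1)) ∣ (n.factorial : ℤ) := ⟨c, by rw [h]; ring⟩
    exact_mod_cast this
  have hval : padicValNat 2 n.factorial = l := by
    rw [padicValNat_factorial (Nat.lt_succ_self (Nat.log 2 n)), hl]
    rfl
  rw [padicValNat_dvd_iff_le n.factorial_ne_zero, hval] at hdvd
  omega

end AltMaj

theorem theorem1p2 (n : ℕ) (hn : 1 ≤ n) :
    (AltMaj.altPoly n).eval 1 = ∑ π : Equiv.Perm (Fin n), (X : ℤ[X]) ^ AltMaj.altmaj π ∧
    (∃ E : ℤ[X],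
      (AltMaj.altPoly n).eval 1 =
        E * ∏ k ∈ Finset.Icc 1 (Nat.log 2 n), ∏ i ∈ Finset.Icc 1 (n / 2 ^ k), (1 + X ^ i) ∧
      AltMaj.IsPalindromic E E.natDegree ∧
      E.coeff 0 = (AltMaj.eulerNumber n : ℤ) ∧
      (n.factorial : ℤ) = 2 ^ (∑ k ∈ Finset.Icc 1 (Nat.log 2 n), n / 2 ^ k) * E.eval 1 ∧
      Odd (E.eval 1)) ∧
    ∀ m : ℕ, 1 ≤ m → (1 + X ^ m) ^ (n / (2 * m)) ∣ (AltMaj.altPoly n).eval 1 := by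
  have hA : (AltMaj.altPoly n).eval 1 = AltMaj.altmajSum X n := by
    rw [AltMaj.eval_one_altPoly, AltMaj.altmajSum_eq_sum]
  refine ⟨AltMaj.eval_one_altPoly n, ?_, fun m hm => hA ▸ AltMaj.one_add_pow_dvd_altmajSum n hm⟩
  obtain ⟨E, hE⟩ := AltMaj.dyadicProd_dvd_altmajSum n (Nat.log 2 n)
  have hfac : (n.factorial : ℤ) =
      2 ^ (∑ k ∈ Finset.Icc 1 (Nat.log 2 n), n / 2 ^ k) * E.eval 1 := by
    rw [← AltMaj.eval_one_altmajSum, hE, eval_mul, AltMaj.eval_one_dyadicProd]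
  refine ⟨E, ?_, ?_, ?_, hfac, AltMaj.odd_of_factorial_eq hfac⟩
  · rw [hA, hE, mul_comm]; rfl
  -- `reverse` is multiplicative over a domain, so the cofactor of a self-reverse divisor in a
  -- self-reverse polynomial is self-reverse.
  · have h := AltMaj.reverse_altmajSum n
    rw [hE, reverse_mul_of_domain, AltMaj.reverse_dyadicProd] at h
    exact AltMaj.isPalindromic_of_reverse_eq
      (mul_left_cancel₀ (AltMaj.monic_dyadicProd n _).ne_zero h)
  · rw [← AltMaj.coeff_zero_altmajSum, hE, mul_coeff_zero, AltMaj.coeff_zero_dyadicProd, one_mul]
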